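/- For a compact convex set $X\subset\mathbb{R}^2$ containing more than one point and $l\ge 0$, let the Buffon probability $P_X(l)$ be the probability that the needle $\{x+t(\cos\theta,\sin\theta):0\le t\le l\}$ is contained in $X$, where the base point $x$ is uniformly distributed in $X$ (with respect to area, or with respect to length if $X$ is a line segment) and the angle $\theta$ is independent of $x$ and uniformly distributed in $[0,2\pi)$. Let $\mathbb{D}$ be the closed unit disk. Theorem. Let $X\subset\mathbb{R}^2$ be compact and convex, with perimeter $\ell(\partial X)=2\pi$ (the length of the topological boundary of $X$), and not a disk. Then there exists $\varepsilon>0$ such that $P_X(l)<P_{\mathbb{D}}(l)$ for all $l\in(0,\varepsilon)$. -/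

import Mathlib

/-- The Euclidean plane. -/
abbrev Plane : Type := EuclideanSpace ℝ (Fin 2)

/-- The unit disk. -/
def unitDisk : Set Plane := Metric.closedBall 0 1

/-- A set is a disk if it is a closed ball of some radius about some centre. -/
def IsDisk (X : Set Plane) : Prop :=
  ∃ (c : Plane) (r : ℝ), X = Metric.closedBall c r

/-- The perimeter: the length (one-dimensional Hausdorff measure) of the topological boundary. -/
noncomputable def perimeter (X : Set Plane) : ENNReal :=
  MeasureTheory.Measure.hausdorffMeasure 1 (frontier X)

/-- The needle of length `l` originating at `x` whose angle with the horizontal axis is `θ`. -/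
noncomputable def needle (l : ℝ) (x : Plane) (θ : ℝ) : Set Plane :=
  segment ℝ x (x + l • !₂[Real.cos θ, Real.sin θ])

open Classical in
/-- The uniform distribution on a bounded convex set `X`: normalised area if `X` has positive area,
normalised length if `X` is a line segment, and the point mass if `X` is a point. -/
noncomputable def uniformPoint (X : Set Plane) : MeasureTheory.Measure Plane :=
  if MeasureTheory.volume X ≠ 0 then
    ProbabilityTheory.cond MeasureTheory.volume X
  else if MeasureTheory.Measure.hausdorffMeasure 1 X ≠ 0 then
    ProbabilityTheory.cond (MeasureTheory.Measure.hausdorffMeasure 1) X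
  else
    ProbabilityTheory.cond (MeasureTheory.Measure.hausdorffMeasure 0) X

/-- The uniform distribution on the angles `[0, 2π)`. -/
noncomputable def uniformAngle : MeasureTheory.Measure ℝ :=
  ProbabilityTheory.cond MeasureTheory.volume (Set.Ico 0 (2 * Real.pi))

/-- The Buffon probability `P_X(l)`: the probability that the needle of length `l`, with base point
uniform in `X` and independent uniform direction, lies within `X`. -/
noncomputable def buffonProb (X : Set Plane) (l : ℝ) : ℝ :=
  ((uniformPoint X).prod uniformAngle).real {p : Plane × ℝ | needle l p.1 p.2 ⊆ X}

namespace Buffon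

open MeasureTheory Topology
open Set hiding pi
open Filter hiding pi
open Real (cos sin pi)

/-! Let `X` have interior, area `A` and `L = girth X`. For a fixed angle, a needle based in `X`
leaves `X` when its base point is within about `l` of the forward end of its chord. By Fubini such
base points have area about `l` times the width of `X` across that direction. The mean width is `L /
π`, so the escape probability is `l * L / (π * A)` to first order, and for the unit disk it is at
most `2 * l / π`. The theorem thus reduces to the strict inequality `2 * A < L`; `buffonProb_le` and
`unitDisk_le_buffonProb` supply the one-sided bounds.

That inequality is isoperimetric and is drawn from Bonnesen's `A ≤ r * L - π * r ^ 2`, with `r` the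
inradius. Peeling `X` from outside in, a strip of width `s` has area at most `s` times the current
girth (`volume_strip_le`), while the girth drops by at least `2 * π * s`; at depth `r` no area is
left. If `L ≤ 2 * A`, then `L = 2 * π * r`, so the support function is that of an inscribed disk.

The hypothesis concerns the Hausdorff length of the boundary, whereas `L` integrates the support
function. Only `L ≤ 2 * π` is needed, because `4 * π * A ≤ L ^ 2` then gives `2 * A ≤ L`. This half
of Cauchy's formula (`girth_le_perimeter`) comes from averaging projections of inscribed polygons. A
set of zero area lies on a line, and almost no needle direction fits in it. -/

/-- The unit vector of angle `θ`. -/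
noncomputable def dir (θ : ℝ) : Plane := !₂[cos θ, sin θ]

/-- The coordinate of `x` in the direction of angle `θ`. -/
noncomputable def along (θ : ℝ) (x : Plane) : ℝ := x 0 * cos θ + x 1 * sin θ

/-- The support function of `X`, as a function of the angle. -/
noncomputable def supp (X : Set Plane) (θ : ℝ) : ℝ := sSup (along θ '' X)

/-- The integral of the support function; for a convex set this is the perimeter. -/
noncomputable def girth (X : Set Plane) : ℝ := ∫ θ in (0 : ℝ)..2 * pi, supp X θ

/-- The parametrisation of the plane by the coordinates in the directions `θ` and `θ + π / 2`. -/
noncomputable def frame (θ : ℝ) (p : ℝ × ℝ) : Plane :=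
  !₂[p.1 * cos θ - p.2 * sin θ, p.1 * sin θ + p.2 * cos θ]

/-! ### Directions and coordinates in the plane -/

lemma norm_sq_plane (x : Plane) : ‖x‖ ^ 2 = x 0 ^ 2 + x 1 ^ 2 := by
  rw [EuclideanSpace.norm_sq_eq]; simp

@[simp] lemma dir_zero (θ : ℝ) : dir θ 0 = cos θ := rfl
@[simp] lemma dir_one (θ : ℝ) : dir θ 1 = sin θ := rfl

lemma along_eq_inner (θ : ℝ) (x : Plane) : along θ x = inner ℝ x (dir θ) := by
  simp [along, dir, PiLp.inner_apply, Fin.sum_univ_two]; ring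

lemma norm_dir (θ : ℝ) : ‖dir θ‖ = 1 := by
  have h := norm_sq_plane (dir θ)
  rw [dir_zero, dir_one, Real.cos_sq_add_sin_sq] at h
  exact (pow_eq_one_iff_of_nonneg (norm_nonneg _) two_ne_zero).1 h

lemma along_add (θ : ℝ) (x y : Plane) : along θ (x + y) = along θ x + along θ y := by
  simp [along]; ring

lemma along_sub (θ : ℝ) (x y : Plane) : along θ (x - y) = along θ x - along θ y := by
  simp [along]; ring

lemma along_smul (θ c : ℝ) (x : Plane) : along θ (c • x) = c * along θ x := by
  simp [along]; ring

lemma along_dir (θ φ : ℝ) : along θ (dir φ) = cos (θ - φ) := by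
  rw [Real.cos_sub]; simp [along]; ring

lemma along_add_pi (θ : ℝ) (x : Plane) : along (θ + pi) x = -along θ x := by
  simp [along]; ring

lemma along_add_two_pi (θ : ℝ) (x : Plane) : along (θ + 2 * pi) x = along θ x := by
  simp [along]

lemma abs_along_le (θ : ℝ) (x : Plane) : |along θ x| ≤ ‖x‖ := by
  rw [along_eq_inner]
  simpa [norm_dir] using abs_real_inner_le_norm x (dir θ)

lemma along_le (θ : ℝ) (x : Plane) : along θ x ≤ ‖x‖ := (le_abs_self _).trans (abs_along_le θ x)

@[fun_prop] lemma continuous_along (θ : ℝ) : Continuous (along θ) := by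
  unfold along; fun_prop

lemma norm_dir_sub_le (θ φ : ℝ) : ‖dir θ - dir φ‖ ≤ |θ - φ| := by
  apply abs_le_of_sq_le_sq' _ (abs_nonneg _) |>.2
  rw [norm_sq_plane, sq_abs]
  have h := Real.one_sub_sq_div_two_le_cos (x := θ - φ)
  rw [Real.cos_sub] at h
  have h1 := Real.cos_sq_add_sin_sq θ
  have h2 := Real.cos_sq_add_sin_sq φ
  simp only [PiLp.sub_apply, dir_zero, dir_one]
  nlinarith

lemma abs_along_sub_along_le (θ φ : ℝ) (x : Plane) :
    |along θ x - along φ x| ≤ ‖x‖ * |θ - φ| := by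
  rw [along_eq_inner, along_eq_inner, ← inner_sub_right]
  exact (abs_real_inner_le_norm _ _).trans
    (mul_le_mul_of_nonneg_left (norm_dir_sub_le θ φ) (norm_nonneg _))

/-- Polar coordinates. -/
lemma exists_eq_norm_smul_dir (x : Plane) : ∃ θ, x = ‖x‖ • dir θ := by
  have hn := norm_sq_plane x
  refine ⟨Complex.arg ⟨x 0, x 1⟩, ?_⟩
  have hz : ‖(⟨x 0, x 1⟩ : ℂ)‖ = ‖x‖ := by
    rw [← sq_eq_sq₀ (norm_nonneg _) (norm_nonneg _), hn, Complex.sq_norm, Complex.normSq_mk]; ring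
  have h1 := Complex.norm_mul_cos_arg ⟨x 0, x 1⟩
  have h2 := Complex.norm_mul_sin_arg ⟨x 0, x 1⟩
  rw [hz] at h1 h2
  ext i
  fin_cases i
  · simpa using h1.symm
  · simpa using h2.symm

lemma exists_along_eq_norm (x : Plane) : ∃ θ, along θ x = ‖x‖ := by
  obtain ⟨θ, h⟩ := exists_eq_norm_smul_dir x
  refine ⟨θ, ?_⟩
  conv_lhs => rw [h]
  rw [along_smul, along_dir]; simp

/-! ### The support function -/

section Support

variable {X : Set Plane}

lemma bddAbove_along (hX : IsCompact X) (θ : ℝ) : BddAbove (along θ '' X) :=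
  (hX.image (continuous_along θ)).bddAbove

lemma along_le_supp (hX : IsCompact X) {x : Plane} (hx : x ∈ X) (θ : ℝ) : along θ x ≤ supp X θ :=
  le_csSup (bddAbove_along hX θ) (mem_image_of_mem _ hx)

lemma exists_along_eq_supp (hX : IsCompact X) (hne : X.Nonempty) (θ : ℝ) :
    ∃ x ∈ X, along θ x = supp X θ :=
  (hX.image (continuous_along θ)).sSup_mem (hne.image _)

lemma supp_le (hne : X.Nonempty) {θ a : ℝ} (h : ∀ x ∈ X, along θ x ≤ a) : supp X θ ≤ a :=
  csSup_le (hne.image _) (by rintro _ ⟨x, hx, rfl⟩; exact h x hx)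

lemma supp_add_two_pi (X : Set Plane) (θ : ℝ) : supp X (θ + 2 * pi) = supp X θ := by
  unfold supp
  rw [show along (θ + 2 * pi) = along θ from funext (along_add_two_pi θ)]

lemma periodic_supp (X : Set Plane) : Function.Periodic (supp X) (2 * pi) := supp_add_two_pi X

lemma abs_supp_sub_supp_le (hX : IsCompact X) (hne : X.Nonempty) {R : ℝ}
    (hR : ∀ x ∈ X, ‖x‖ ≤ R) (θ φ : ℝ) : |supp X θ - supp X φ| ≤ R * |θ - φ| := by
  have key : ∀ θ φ, supp X θ - supp X φ ≤ R * |θ - φ| := by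
    intro θ φ
    obtain ⟨x, hx, h⟩ := exists_along_eq_supp hX hne θ
    have h1 := along_le_supp hX hx φ
    have h2 := (le_abs_self _).trans (abs_along_sub_along_le θ φ x)
    have h3 := mul_le_mul_of_nonneg_right (hR x hx) (abs_nonneg (θ - φ))
    linarith
  rw [abs_sub_le_iff]
  exact ⟨key θ φ, by rw [abs_sub_comm]; exact key φ θ⟩

lemma exists_norm_bound (hX : IsCompact X) : ∃ R, 0 < R ∧ ∀ x ∈ X, ‖x‖ ≤ R := by
  obtain ⟨R, h0, h⟩ := hX.isBounded.exists_pos_norm_le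
  exact ⟨R, h0, h⟩

lemma continuous_supp (hX : IsCompact X) (hne : X.Nonempty) : Continuous (supp X) := by
  obtain ⟨R, h0, hR⟩ := exists_norm_bound hX
  have : LipschitzWith ⟨R, h0.le⟩ (supp X) := LipschitzWith.of_dist_le_mul fun θ φ =>
    abs_supp_sub_supp_le hX hne hR θ φ
  exact this.continuous

/-- Test both neighbouring directions on a point of `X` extremal in direction `θ`. This makes the
sides of circumscribed polygons have nonnegative length. -/
lemma two_cos_mul_supp_le (hX : IsCompact X) (hne : X.Nonempty) (θ δ : ℝ) :
    2 * cos δ * supp X θ ≤ supp X (θ + δ) + supp X (θ - δ) := by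
  obtain ⟨x, hx, h⟩ := exists_along_eq_supp hX hne θ
  have h1 := along_le_supp hX hx (θ + δ)
  have h2 := along_le_supp hX hx (θ - δ)
  have h3 : along (θ + δ) x + along (θ - δ) x = 2 * cos δ * along θ x := by
    simp only [along, Real.cos_add, Real.cos_sub, Real.sin_add, Real.sin_sub]; ring
  rw [← h]; linarith

/-- A point outside is strictly separated by a linear functional, which is a multiple of some `along
θ`. -/
lemma mem_of_along_le_supp (hX : IsCompact X) (hconv : Convex ℝ X) (hne : X.Nonempty) {x : Plane}
    (h : ∀ θ, along θ x ≤ supp X θ) : x ∈ X := by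
  by_contra hx
  obtain ⟨f, a, hf, ha⟩ := geometric_hahn_banach_closed_point hconv hX.isClosed hx
  obtain ⟨v, hv⟩ : ∃ v : Plane, ∀ y, f y = inner ℝ y v :=
    ⟨(InnerProductSpace.toDual ℝ Plane).symm f, fun y => by
      rw [real_inner_comm, InnerProductSpace.toDual_symm_apply]⟩
  obtain ⟨θ, hθ⟩ := exists_eq_norm_smul_dir v
  have hf' : ∀ y, f y = ‖v‖ * along θ y := fun y => by
    rw [hv, along_eq_inner]
    conv_lhs => rw [hθ]
    rw [inner_smul_right]
  obtain ⟨y, hy, hye⟩ := exists_along_eq_supp hX hne θ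
  have h1 := hf y hy
  rw [hf', hye] at h1
  rw [hf'] at ha
  have := mul_le_mul_of_nonneg_left (h θ) (norm_nonneg v)
  linarith

end Support

/-! ### Rotated coordinates -/

section Frame

lemma along_frame (θ : ℝ) (p : ℝ × ℝ) : along θ (frame θ p) = p.1 := by
  simp only [along, frame, PiLp.toLp_apply, Matrix.cons_val_zero, Matrix.cons_val_one]
  linear_combination p.1 * Real.cos_sq_add_sin_sq θ

lemma along_add_pi_div_two_frame (θ : ℝ) (p : ℝ × ℝ) :
    along (θ + pi / 2) (frame θ p) = p.2 := by
  simp only [along, frame, PiLp.toLp_apply, Matrix.cons_val_zero, Matrix.cons_val_one,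
    Real.cos_add_pi_div_two, Real.sin_add_pi_div_two]
  linear_combination p.2 * Real.cos_sq_add_sin_sq θ

lemma frame_along (θ : ℝ) (x : Plane) : frame θ (along θ x, along (θ + pi / 2) x) = x := by
  ext i
  fin_cases i
  · simp [along, frame, Real.cos_add_pi_div_two, Real.sin_add_pi_div_two]
    linear_combination x 0 * Real.cos_sq_add_sin_sq θ
  · simp [along, frame, Real.cos_add_pi_div_two, Real.sin_add_pi_div_two]
    linear_combination x 1 * Real.cos_sq_add_sin_sq θ

lemma frame_add_smul_dir (θ s t l : ℝ) :
    frame θ (s, t) + l • dir θ = frame θ (s + l, t) := by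
  ext i
  fin_cases i <;> simp [frame] <;> ring

@[fun_prop] lemma continuous_frame (θ : ℝ) : Continuous (frame θ) := by
  unfold frame; fun_prop

lemma along_add_frame (θ φ : ℝ) (p : ℝ × ℝ) :
    along (θ + φ) (frame θ p) = p.1 * cos φ + p.2 * sin φ := by
  simp only [along, frame, PiLp.toLp_apply, Matrix.cons_val_zero, Matrix.cons_val_one,
    Real.cos_add, Real.sin_add]
  linear_combination (p.1 * cos φ + p.2 * sin φ) * Real.cos_sq_add_sin_sq θ

lemma measurePreserving_frame (θ : ℝ) : MeasurePreserving (frame θ) := by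
  let r : Plane →ₗ[ℝ] Plane :=
    { toFun := fun x => frame θ (x 0, x 1)
      map_add' := fun x y => by ext i; fin_cases i <;> simp [frame] <;> ring
      map_smul' := fun c x => by ext i; fin_cases i <;> simp [frame] <;> ring }
  let ri : Plane →ₗᵢ[ℝ] Plane := ⟨r, fun x => by
    rw [← sq_eq_sq₀ (norm_nonneg _) (norm_nonneg _), norm_sq_plane, norm_sq_plane]
    simp only [r, frame, LinearMap.coe_mk, AddHom.coe_mk, PiLp.toLp_apply, Matrix.cons_val_zero,
      Matrix.cons_val_one]
    linear_combination (x 0 ^ 2 + x 1 ^ 2) * Real.cos_sq_add_sin_sq θ⟩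
  have h1 := (ri.toLinearIsometryEquiv rfl).measurePreserving
  have h2 := PiLp.volume_preserving_toLp (Fin 2)
  have h3 := (volume_preserving_finTwoArrow ℝ).symm
  exact h1.comp (h2.comp h3)

lemma volume_frame_preimage (θ : ℝ) {E : Set Plane} (hE : MeasurableSet E) :
    volume (frame θ ⁻¹' E) = volume E :=
  (measurePreserving_frame θ).measure_preimage hE.nullMeasurableSet

end Frame

lemma intervalIntegrable_supp {X : Set Plane} (hX : IsCompact X) (hne : X.Nonempty) (a b : ℝ) :
    IntervalIntegrable (supp X) volume a b := (continuous_supp hX hne).intervalIntegrable a b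

lemma integral_along (c : Plane) : ∫ θ in (0 : ℝ)..2 * pi, along θ c = 0 := by
  unfold along
  rw [intervalIntegral.integral_add (by apply Continuous.intervalIntegrable; fun_prop)
    (by apply Continuous.intervalIntegrable; fun_prop),
    intervalIntegral.integral_const_mul, intervalIntegral.integral_const_mul]
  simp

lemma integral_supp_add (X : Set Plane) (a : ℝ) :
    ∫ θ in (0 : ℝ)..2 * pi, supp X (θ + a) = girth X := by
  rw [intervalIntegral.integral_comp_add_right]
  have := (periodic_supp X).intervalIntegral_add_eq a 0
  rw [zero_add, add_comm a] at this
  rw [zero_add, this, girth]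

/-- The centre `c` contributes nothing: `along θ c` averages to zero over a full turn. -/
lemma two_pi_mul_le_girth {X : Set Plane} (hX : IsCompact X) (hne : X.Nonempty) {c : Plane} {r : ℝ}
    (h : ∀ θ, along θ c + r ≤ supp X θ) : 2 * pi * r ≤ girth X := by
  have hc : Continuous fun θ => along θ c := by unfold along; fun_prop
  have h1 : ∫ θ in (0 : ℝ)..2 * pi, (along θ c + r) ≤ girth X :=
    intervalIntegral.integral_mono_on (by positivity)
      ((hc.add continuous_const).intervalIntegrable _ _) (intervalIntegrable_supp hX hne _ _)
      fun θ _ => h θ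
  rw [intervalIntegral.integral_add (hc.intervalIntegrable _ _) (by simp), integral_along] at h1
  simpa using h1

lemma girth_nonneg {X : Set Plane} (hX : IsCompact X) (hne : X.Nonempty) : 0 ≤ girth X := by
  obtain ⟨c, hc⟩ := hne
  simpa using two_pi_mul_le_girth (r := 0) hX ⟨c, hc⟩ fun θ => by
    simpa using along_le_supp hX hc θ

/-! ### The area of an inner strip -/

section Strip

/-- The rectangle with sides parallel to the directions `θ` and `θ + π / 2`. -/
def rect (θ : ℝ) (I J : Set ℝ) : Set Plane := {x | along θ x ∈ I ∧ along (θ + pi / 2) x ∈ J}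

lemma volume_rect (θ a b c d : ℝ) :
    volume (rect θ (Icc a b) (Icc c d)) = ENNReal.ofReal (b - a) * ENNReal.ofReal (d - c) := by
  have hm : MeasurableSet (rect θ (Icc a b) (Icc c d)) :=
    ((isClosed_Icc.preimage (continuous_along θ)).inter
      (isClosed_Icc.preimage (continuous_along (θ + pi / 2)))).measurableSet
  have : frame θ ⁻¹' rect θ (Icc a b) (Icc c d) = Icc a b ×ˢ Icc c d := by
    ext p
    simp only [rect, mem_preimage, mem_ofPred_eq, along_frame, along_add_pi_div_two_frame, mem_prod]
  rw [← volume_frame_preimage θ hm, this, Measure.volume_eq_prod, Measure.prod_prod,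
    Real.volume_Icc, Real.volume_Icc]

lemma volume_real_rect (θ : ℝ) {a b c d : ℝ} (hab : a ≤ b) (hcd : c ≤ d) :
    volume.real (rect θ (Icc a b) (Icc c d)) = (b - a) * (d - c) := by
  rw [measureReal_def, volume_rect, ENNReal.toReal_mul, ENNReal.toReal_ofReal (by linarith),
    ENNReal.toReal_ofReal (by linarith)]

/-- The inner parallel body at distance `s`. -/
def erode (X : Set Plane) (s : ℝ) : Set Plane := {x | ∀ θ, along θ x + s ≤ supp X θ}

/-- A second difference of the support function: `side X δ θ / sin δ` is the length of a side of the
circumscribed polygon with normals in the directions `θ + k * δ`. -/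
noncomputable def side (X : Set Plane) (δ θ : ℝ) : ℝ :=
  supp X (θ + δ) + supp X (θ - δ) - 2 * cos δ * supp X θ

lemma side_nonneg {X : Set Plane} (hX : IsCompact X) (hne : X.Nonempty) (δ θ : ℝ) :
    0 ≤ side X δ θ := sub_nonneg.2 (two_cos_mul_supp_le hX hne θ δ)

lemma continuous_side {X : Set Plane} (hX : IsCompact X) (hne : X.Nonempty) (δ : ℝ) :
    Continuous (side X δ) := by
  have := continuous_supp hX hne
  unfold side; fun_prop

/-- By periodicity the shifts by `δ` leave the integral unchanged. The factor is of order `δ ^ 2`: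
one `δ` cancels the averaging over `φ`, the other the division by `sin δ`. -/
lemma integral_side {X : Set Plane} (hX : IsCompact X) (hne : X.Nonempty) (δ : ℝ) :
    ∫ θ in (0 : ℝ)..2 * pi, side X δ θ = 2 * (1 - cos δ) * girth X := by
  have hc := continuous_supp hX hne
  have h1 : IntervalIntegrable (fun θ => supp X (θ + δ)) volume 0 (2 * pi) :=
    Continuous.intervalIntegrable (by fun_prop) _ _
  have h2 : IntervalIntegrable (fun θ => supp X (θ - δ)) volume 0 (2 * pi) :=
    Continuous.intervalIntegrable (by fun_prop) _ _
  have h3 : IntervalIntegrable (fun θ => 2 * cos δ * supp X θ) volume 0 (2 * pi) :=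
    Continuous.intervalIntegrable (by fun_prop) _ _
  have h4 : ∫ θ in (0 : ℝ)..2 * pi, supp X (θ - δ) = girth X := integral_supp_add X (-δ)
  unfold side
  rw [intervalIntegral.integral_sub (h1.add h2) h3, intervalIntegral.integral_add h1 h2,
    integral_supp_add, h4, intervalIntegral.integral_const_mul, ← girth]
  ring

/-- Averaging the polygon over its rotation `φ` turns the sum over sides into an exact integral, so
no Riemann sum has to converge. -/
lemma integral_sum_translates {f : ℝ → ℝ} (hf : Continuous f) (n : ℕ) {δ : ℝ} :
    ∫ φ in (0 : ℝ)..δ, ∑ k ∈ Finset.range n, f (φ + k * δ) = ∫ φ in (0 : ℝ)..n * δ, f φ := by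
  rw [intervalIntegral.integral_finsetSum fun k _ =>
    Continuous.intervalIntegrable (by fun_prop) _ _]
  have := intervalIntegral.sum_integral_adjacent_intervals (f := f) (μ := volume)
    (a := fun k : ℕ => k * δ) (n := n) fun k _ => hf.intervalIntegrable _ _
  simp only [Nat.cast_zero, zero_mul] at this
  rw [← this]
  refine Finset.sum_congr rfl fun k _ => ?_
  rw [intervalIntegral.integral_comp_add_right]
  congr 1 <;> push_cast <;> ring

/-- The angles `φ + k * δ` for integers `k` are those for `k < n`, up to multiples of `2 * π`. -/
lemma exists_lt_periodic_eq {f : ℝ → ℝ} (hf : Function.Periodic f (2 * pi)) {n : ℕ} (hn : 0 < n)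
    {δ : ℝ} (hδ : n * δ = 2 * pi) (φ : ℝ) (m : ℤ) :
    ∃ k < n, f (φ + m * δ) = f (φ + k * δ) := by
  have hn' : (0 : ℤ) < n := by exact_mod_cast hn
  refine ⟨(m % n).toNat, ?_, ?_⟩
  · have := Int.emod_lt_of_pos m hn'
    have := Int.emod_nonneg m hn'.ne'
    omega
  · have h0 : (((m % n).toNat : ℤ) : ℝ) = ((m % n : ℤ) : ℝ) := by
      rw [Int.toNat_of_nonneg (Int.emod_nonneg m hn'.ne')]
    have h1 : (m : ℝ) = ((m % n : ℤ) : ℝ) + n * ((m / n : ℤ) : ℝ) := by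
      exact_mod_cast (Int.emod_add_mul_ediv m n).symm
    have h2 : φ + m * δ = φ + ((m % n).toNat : ℝ) * δ + ((m / n : ℤ) : ℝ) * (2 * pi) := by
      rw [← Int.cast_natCast, h0, ← hδ]
      conv_lhs => rw [h1]
      ring
    rw [h2, hf.int_mul]

/-- A point of `X` close to the boundary lies in one of the rectangles erected inwards on the sides
of a circumscribed polygon. -/
lemma exists_mem_rect {X : Set Plane} (hX : IsCompact X) {R : ℝ}
    (hR : ∀ x ∈ X, ‖x‖ ≤ R) {n : ℕ} (hn : 0 < n) {δ : ℝ} (hδ : n * δ = 2 * pi)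
    (hsin : 0 < sin δ) (φ : ℝ) {s : ℝ} {x : Plane} (hx : x ∈ X) (hxs : x ∉ erode X s) :
    ∃ k < n, x ∈ rect (φ + k * δ)
      (Icc (supp X (φ + k * δ) - (s + 2 * R * δ)) (supp X (φ + k * δ)))
      (Icc (-((supp X (φ + k * δ - δ) - cos δ * supp X (φ + k * δ)) / sin δ))
        ((supp X (φ + k * δ + δ) - cos δ * supp X (φ + k * δ)) / sin δ)) := by
  have hδ0 : 0 < δ := by
    have : (0 : ℝ) < n := by exact_mod_cast hn
    have h2 : 0 < n * δ := by rw [hδ]; positivity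
    exact (mul_pos_iff_of_pos_left this).1 h2
  set g : ℝ → ℝ := fun θ => supp X θ - along θ x with hg
  have hgp : Function.Periodic g (2 * pi) := fun θ => by
    simp only [hg, supp_add_two_pi, along_add_two_pi]
  -- Choose the side line nearest to `x`. Periodicity extends minimality to all integer indices, so
  -- both neighbours of `k` can be compared cyclically.
  obtain ⟨k, hk, hmin⟩ := Finset.exists_min_image (Finset.range n) (fun k : ℕ => g (φ + k * δ))
    ⟨0, Finset.mem_range.2 hn⟩
  have hmin' : ∀ m : ℤ, g (φ + k * δ) ≤ g (φ + m * δ) := fun m => by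
    obtain ⟨j, hj, hje⟩ := exists_lt_periodic_eq hgp hn hδ φ m
    rw [hje]
    exact hmin j (Finset.mem_range.2 hj)
  obtain ⟨θ, hθ⟩ : ∃ θ, supp X θ < along θ x + s := by simpa [erode] using hxs
  -- Some grid direction is within `δ` of `θ`; the support function and `along` each change by at
  -- most `R * δ`, whence `2 * R * δ`.
  have hclose : g (φ + k * δ) ≤ s + 2 * R * δ := by
    have h1 := hmin' ⌊(θ - φ) / δ⌋
    set m := ⌊(θ - φ) / δ⌋
    have h2 : m * δ ≤ θ - φ := (le_div_iff₀ hδ0).1 (Int.floor_le _)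
    have h3 : θ - φ < (m + 1) * δ := (div_lt_iff₀ hδ0).1 (Int.lt_floor_add_one _)
    have h4 : |φ + m * δ - θ| ≤ δ := by rw [abs_le]; constructor <;> linarith
    have h5 := (le_abs_self _).trans (abs_supp_sub_supp_le hX ⟨x, hx⟩ hR (φ + m * δ) θ)
    have h6 := (neg_le_abs _).trans (abs_along_sub_along_le (φ + m * δ) θ x)
    have hR0 : 0 ≤ R := (norm_nonneg _).trans (hR x hx)
    have h7 : R * |φ + m * δ - θ| ≤ R * δ := mul_le_mul_of_nonneg_left h4 hR0
    have h8 : ‖x‖ * |φ + m * δ - θ| ≤ R * δ :=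
      mul_le_mul (hR x hx) h4 (abs_nonneg _) hR0
    simp only [hg] at h1 ⊢
    linarith
  have hnext := hmin' (k + 1)
  have hprev := hmin' (k - 1)
  push_cast at hnext hprev
  rw [show φ + ((k : ℝ) + 1) * δ = φ + k * δ + δ by ring] at hnext
  rw [show φ + ((k : ℝ) - 1) * δ = φ + k * δ - δ by ring] at hprev
  refine ⟨k, Finset.mem_range.1 hk, ?_⟩
  set ψ := φ + k * δ
  have hle := along_le_supp hX hx ψ
  -- This replaces `along ψ x` by `supp X ψ` when minimality against the neighbours is turned into
  -- bounds on the tangential coordinate.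
  have hmul : 0 ≤ (supp X ψ - along ψ x) * (1 - cos δ) :=
    mul_nonneg (by linarith) (by linarith [Real.cos_le_one δ])
  have e1 : along (ψ + δ) x = along ψ x * cos δ + along (ψ + pi / 2) x * sin δ := by
    conv_lhs => rw [← frame_along ψ x]
    rw [along_add_frame]
  have e2 : along (ψ - δ) x = along ψ x * cos δ - along (ψ + pi / 2) x * sin δ := by
    conv_lhs => rw [← frame_along ψ x, sub_eq_add_neg]
    rw [along_add_frame]; simp; ring
  simp only [hg] at hnext hprev hclose
  refine ⟨⟨by linarith, hle⟩, ?_, ?_⟩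
  · rw [neg_le, le_div_iff₀ hsin]; nlinarith
  · rw [le_div_iff₀ hsin]; nlinarith

lemma volume_strip_le_sum {X : Set Plane} (hX : IsCompact X) (hne : X.Nonempty) {R : ℝ}
    (hR : ∀ x ∈ X, ‖x‖ ≤ R) {n : ℕ} (hn : 0 < n) {δ : ℝ} (hδ : n * δ = 2 * pi)
    (hsin : 0 < sin δ) (φ : ℝ) {s : ℝ} (hs : 0 ≤ s + 2 * R * δ) :
    volume.real (X \ erode X s) * sin δ ≤
      (s + 2 * R * δ) * ∑ k ∈ Finset.range n, side X δ (φ + k * δ) := by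
  have hsub : X \ erode X s ⊆ ⋃ k ∈ Finset.range n, rect (φ + k * δ)
      (Icc (supp X (φ + k * δ) - (s + 2 * R * δ)) (supp X (φ + k * δ)))
      (Icc (-((supp X (φ + k * δ - δ) - cos δ * supp X (φ + k * δ)) / sin δ))
        ((supp X (φ + k * δ + δ) - cos δ * supp X (φ + k * δ)) / sin δ)) := by
    intro x hx
    obtain ⟨k, hk, h⟩ := exists_mem_rect hX hR hn hδ hsin φ hx.1 hx.2
    exact mem_biUnion (Finset.mem_coe.2 (Finset.mem_range.2 hk)) h
  have hside : ∀ k : ℕ, (supp X (φ + k * δ + δ) - cos δ * supp X (φ + k * δ)) / sin δ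
      - -((supp X (φ + k * δ - δ) - cos δ * supp X (φ + k * δ)) / sin δ)
      = side X δ (φ + k * δ) / sin δ := fun k => by unfold side; ring
  have h1 := (measureReal_mono (μ := volume) hsub (by
    refine ((measure_biUnion_finset_le _ _).trans_lt ?_).ne
    refine ENNReal.sum_lt_top.2 fun k _ => ?_
    rw [volume_rect]
    exact ENNReal.mul_lt_top ENNReal.ofReal_lt_top ENNReal.ofReal_lt_top)).trans
    (measureReal_biUnion_finset_le _ _)
  rw [Finset.sum_congr rfl fun (k : ℕ) _ => volume_real_rect (φ + k * δ)
    (by linarith : supp X (φ + k * δ) - (s + 2 * R * δ) ≤ supp X (φ + k * δ))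
    (sub_nonneg.1 (by rw [hside]; exact div_nonneg (side_nonneg hX hne _ _) hsin.le))] at h1
  simp only [hside, sub_sub_cancel] at h1
  rw [← Finset.mul_sum, ← Finset.sum_div, ← mul_div_assoc, le_div_iff₀ hsin] at h1
  exact h1

/-- The inner strip of width `s` has area at most `s` times the perimeter. -/
theorem volume_strip_le {X : Set Plane} (hX : IsCompact X) (hne : X.Nonempty) {s : ℝ} (hs : 0 ≤ s) :
    volume.real (X \ erode X s) ≤ s * girth X := by
  obtain ⟨R, hR0, hR⟩ := exists_norm_bound hX
  -- At least three sides ensure `δ < π`, hence `sin δ > 0`. Writing the bound with `sinc` makes the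
  -- limit `δ → 0` immediate.
  have key : ∀ n : ℕ, 3 ≤ n → volume.real (X \ erode X s) * Real.sinc (2 * pi / n) ≤
      (s + 2 * R * (2 * pi / n)) * girth X := by
    intro n hn
    have hn0 : (0 : ℝ) < n := by positivity
    have hn3 : (3 : ℝ) ≤ n := by exact_mod_cast hn
    set δ := 2 * pi / n with hδdef
    have hδ0 : 0 < δ := by positivity
    have hδ : n * δ = 2 * pi := by rw [hδdef]; field_simp
    have hδpi : δ < pi := by
      rw [hδdef, div_lt_iff₀ hn0]; nlinarith [Real.pi_pos]
    have hsin : 0 < sin δ := Real.sin_pos_of_pos_of_lt_pi hδ0 hδpi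
    have hs' : 0 ≤ s + 2 * R * δ := by positivity
    have hcont := continuous_side hX hne δ
    have h1 : ∫ _ in (0 : ℝ)..δ, volume.real (X \ erode X s) * sin δ ≤
        ∫ φ in (0 : ℝ)..δ, (s + 2 * R * δ) * ∑ k ∈ Finset.range n, side X δ (φ + k * δ) :=
      intervalIntegral.integral_mono_on hδ0.le (by simp)
        (Continuous.intervalIntegrable (by fun_prop) _ _)
        fun φ _ => volume_strip_le_sum hX hne hR (by omega) hδ hsin φ hs'
    rw [intervalIntegral.integral_const, intervalIntegral.integral_const_mul,
      integral_sum_translates hcont, hδ, integral_side hX hne, sub_zero, smul_eq_mul] at h1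
    have hcos := Real.one_sub_sq_div_two_le_cos (x := δ)
    have h2 : 2 * (1 - cos δ) * girth X ≤ δ ^ 2 * girth X :=
      mul_le_mul_of_nonneg_right (by linarith) (girth_nonneg hX hne)
    have h3 := mul_le_mul_of_nonneg_left h2 hs'
    rw [Real.sinc_of_ne_zero hδ0.ne', ← mul_div_assoc, div_le_iff₀ hδ0]
    have h4 : δ * (volume.real (X \ erode X s) * sin δ) ≤
        δ * ((s + 2 * R * δ) * girth X * δ) := by linarith
    exact le_of_mul_le_mul_left h4 hδ0
  have hlim : Tendsto (fun n : ℕ => 2 * pi / (n : ℝ)) atTop (𝓝 0) :=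
    tendsto_const_div_atTop_nhds_zero_nat _
  have hL : Tendsto (fun n : ℕ => volume.real (X \ erode X s) * Real.sinc (2 * pi / n)) atTop
      (𝓝 (volume.real (X \ erode X s) * Real.sinc 0)) :=
    ((Real.continuous_sinc.tendsto 0).comp hlim).const_mul _
  have hRt : Tendsto (fun n : ℕ => (s + 2 * R * (2 * pi / n)) * girth X) atTop
      (𝓝 ((s + 2 * R * 0) * girth X)) :=
    ((hlim.const_mul _).const_add _).mul_const _
  have := le_of_tendsto_of_tendsto hL hRt (eventually_atTop.2 ⟨3, key⟩)
  simpa using this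

end Strip

/-! ### Inner parallel bodies and the isoperimetric inequality -/

section Erode

variable {X : Set Plane}

lemma erode_zero (hX : IsCompact X) (hconv : Convex ℝ X) (hne : X.Nonempty) : erode X 0 = X := by
  ext x
  simp only [erode, add_zero, mem_ofPred_eq]
  exact ⟨mem_of_along_le_supp hX hconv hne, fun hx => along_le_supp hX hx⟩

lemma erode_anti {s t : ℝ} (hst : s ≤ t) : erode X t ⊆ erode X s :=
  fun x hx θ => by linarith [hx θ]

lemma isClosed_erode (s : ℝ) : IsClosed (erode X s) := by
  simp only [erode, ofPred_forall]
  exact isClosed_iInter fun θ => isClosed_le (by fun_prop) continuous_const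

lemma isCompact_erode (hX : IsCompact X) (hconv : Convex ℝ X) (hne : X.Nonempty) {s : ℝ}
    (hs : 0 ≤ s) : IsCompact (erode X s) :=
  hX.of_isClosed_subset (isClosed_erode s)
    ((erode_anti hs).trans (erode_zero hX hconv hne).subset)

lemma convex_erode (s : ℝ) : Convex ℝ (erode X s) := by
  intro x hx y hy a b ha hb hab θ
  rw [along_add, along_smul, along_smul]
  have h1 := mul_le_mul_of_nonneg_left (hx θ) ha
  have h2 := mul_le_mul_of_nonneg_left (hy θ) hb
  have h3 : a * supp X θ + b * supp X θ = supp X θ := by rw [← add_mul, hab, one_mul]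
  have h4 : a * s + b * s = s := by rw [← add_mul, hab, one_mul]
  linarith

lemma supp_erode_le {s : ℝ} (hne : (erode X s).Nonempty) (θ : ℝ) :
    supp (erode X s) θ ≤ supp X θ - s :=
  supp_le hne fun x hx => by linarith [hx θ]

lemma erode_erode_subset {s t : ℝ} (hne : (erode X s).Nonempty) :
    erode (erode X s) t ⊆ erode X (s + t) :=
  fun x hx θ => by linarith [hx θ, supp_erode_le hne θ]

lemma girth_erode_le (hX : IsCompact X) (hconv : Convex ℝ X) (hne : X.Nonempty) {s : ℝ}
    (hs : 0 ≤ s) (hnes : (erode X s).Nonempty) : girth (erode X s) ≤ girth X - 2 * pi * s := by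
  have h1 := intervalIntegral.integral_mono_on (μ := volume) (a := 0) (b := 2 * pi) (by positivity)
    (intervalIntegrable_supp (isCompact_erode hX hconv hne hs) hnes _ _)
    ((intervalIntegrable_supp hX hne _ _).sub (by simp : IntervalIntegrable (fun _ => s) _ _ _))
    fun θ _ => supp_erode_le hnes θ
  rw [intervalIntegral.integral_sub (intervalIntegrable_supp hX hne _ _) (by simp)] at h1
  simpa [girth] using h1

/-- The strip removed at depth `k * s` has area at most `s * (girth X - 2 * π * k * s)`; sum over `k
< m`. -/
lemma volume_le_volume_erode_add (hX : IsCompact X) (hconv : Convex ℝ X) (hne : X.Nonempty)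
    {s : ℝ} (hs : 0 ≤ s) (m : ℕ) (hnes : (erode X (m * s)).Nonempty) :
    volume.real X ≤ volume.real (erode X (m * s)) + m * s * girth X - pi * s ^ 2 * (m * (m - 1)) := by
  induction m with
  | zero => simp [erode_zero hX hconv hne]
  | succ m ih =>
    push_cast at hnes ⊢
    have hne' : (erode X (m * s)).Nonempty := hnes.mono (erode_anti (by linarith))
    have h0 := ih hne'
    have hms : 0 ≤ m * s := by positivity
    have hc := isCompact_erode hX hconv hne hms
    have h1 := volume_strip_le hc hne' hs
    have h2 := mul_le_mul_of_nonneg_left (girth_erode_le hX hconv hne hms hne') hs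
    have h3 : volume.real (erode X (m * s)) ≤ volume.real (erode X (m * s) \ erode (erode X (m * s)) s)
        + volume.real (erode X ((m + 1) * s)) := by
      refine (measureReal_mono (fun x hx => ?_) ?_).trans (measureReal_union_le _ _)
      · by_cases h : x ∈ erode (erode X (m * s)) s
        · right
          have := erode_erode_subset hne' h
          rwa [← add_one_mul] at this
        · exact Or.inl ⟨hx, h⟩
      · refine (measure_union_lt_top ?_ ?_).ne
        · exact (measure_mono sdiff_subset).trans_lt hc.measure_lt_top
        · exact (isCompact_erode hX hconv hne (by positivity)).measure_lt_top
    nlinarith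

/-- The inradius: the largest `r` such that the inner parallel body at distance `r` is nonempty. -/
lemma exists_max_erode (hX : IsCompact X) (hconv : Convex ℝ X) (hne : X.Nonempty) :
    ∃ r, 0 ≤ r ∧ (erode X r).Nonempty ∧ ∀ s, (erode X s).Nonempty → s ≤ r := by
  set K : Set (Plane × ℝ) := {p | p.1 ∈ X ∧ 0 ≤ p.2 ∧ p.1 ∈ erode X p.2} with hK
  have hbound : ∀ s, (erode X s).Nonempty → s ≤ (supp X 0 + supp X pi) / 2 := by
    rintro s ⟨x, hx⟩
    have h1 := hx 0
    have h2 := hx pi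
    have h3 := along_add_pi 0 x
    rw [zero_add] at h3
    linarith
  have hclosed : IsClosed {p : Plane × ℝ | p.1 ∈ erode X p.2} := by
    have : {p : Plane × ℝ | p.1 ∈ erode X p.2} =
        ⋂ θ, {p | along θ p.1 + p.2 ≤ supp X θ} := by ext; simp [erode]
    rw [this]
    exact isClosed_iInter fun θ => isClosed_le (by fun_prop) continuous_const
  have hcomp : IsCompact K := by
    refine (hX.prod (isCompact_Icc (a := (0 : ℝ)) (b := (supp X 0 + supp X pi) / 2))).of_isClosed_subset
      ?_ ?_
    · exact (hX.isClosed.preimage continuous_fst).inter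
        ((isClosed_le continuous_const continuous_snd).inter hclosed)
    · rintro p ⟨h1, h2, h3⟩
      exact ⟨h1, h2, hbound _ ⟨_, h3⟩⟩
  obtain ⟨x, hx⟩ := hne
  have hx0 : x ∈ erode X 0 := by rwa [erode_zero hX hconv ⟨x, hx⟩]
  obtain ⟨p, hp, hmax⟩ := hcomp.exists_isMaxOn ⟨(x, 0), hx, le_rfl, hx0⟩ continuous_snd.continuousOn
  refine ⟨p.2, hp.2.1, ⟨p.1, hp.2.2⟩, ?_⟩
  rintro s ⟨y, hy⟩
  by_cases hs : 0 ≤ s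
  · refine hmax (a := (y, s)) ⟨?_, hs, hy⟩
    have := erode_anti hs hy
    rwa [erode_zero hX hconv ⟨x, hx⟩] at this
  · linarith [hp.2.1]

/-- Positive area would give, by convexity, an interior ball of some radius `ε`, whose centre
survives erosion to depth `r + ε`. -/
lemma volume_erode_max {r : ℝ} (hmax : ∀ s, (erode X s).Nonempty → s ≤ r) : volume (erode X r) = 0 := by
  by_contra h0
  have hint : (interior (erode X r)).Nonempty := by
    by_contra h
    rw [not_nonempty_iff_eq_empty] at h
    have h1 := (convex_erode (X := X) r).addHaar_frontier volume
    rw [frontier, h, sdiff_empty, (isClosed_erode r).closure_eq] at h1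
    exact h0 h1
  obtain ⟨c, hc⟩ := hint
  obtain ⟨ε, hε, hball⟩ := Metric.nhds_basis_closedBall.mem_iff.1 (mem_interior_iff_mem_nhds.1 hc)
  have hcr : c ∈ erode X (r + ε) := fun θ => by
    have hm : c + ε • dir θ ∈ Metric.closedBall c ε := by
      simp [Metric.mem_closedBall, dist_eq_norm, norm_smul, norm_dir, abs_of_pos hε]
    have h := hball hm θ
    rw [along_add, along_smul, along_dir, sub_self, Real.cos_zero] at h
    linarith
  linarith [hmax _ ⟨c, hcr⟩]

/-- Bonnesen's inequality for the inradius. -/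
theorem volume_le_inradius_mul (hX : IsCompact X) (hconv : Convex ℝ X) (hne : X.Nonempty) :
    ∃ r c, 0 ≤ r ∧ c ∈ erode X r ∧ volume.real X ≤ r * girth X - pi * r ^ 2 := by
  obtain ⟨r, hr, ⟨c, hc⟩, hmax⟩ := exists_max_erode hX hconv hne
  refine ⟨r, c, hr, hc, ?_⟩
  have key : ∀ m : ℕ, 1 ≤ m → volume.real X ≤ r * girth X - pi * r ^ 2 * (1 - 1 / m) := by
    intro m hm
    have hm0 : (0 : ℝ) < m := by exact_mod_cast hm
    have hmr : m * (r / m) = r := by field_simp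
    -- Peel in `m` layers of thickness `r / m`; the discretisation error vanishes as `m → ∞`.
    have h := volume_le_volume_erode_add hX hconv hne (s := r / m) (by positivity) m
      (by rw [hmr]; exact ⟨c, hc⟩)
    rw [hmr, measureReal_def, measureReal_def, volume_erode_max hmax] at h
    rw [measureReal_def]
    refine h.trans_eq ?_
    simp only [ENNReal.toReal_zero]
    field_simp
    ring
  have hlim : Tendsto (fun m : ℕ => r * girth X - pi * r ^ 2 * (1 - 1 / (m : ℝ))) atTop
      (𝓝 (r * girth X - pi * r ^ 2 * (1 - 0))) :=
    ((tendsto_one_div_atTop_nhds_zero_nat.const_sub 1).const_mul _).const_sub _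
  have := ge_of_tendsto hlim (eventually_atTop.2 ⟨1, key⟩)
  simpa using this

/-- A consequence of the isoperimetric inequality with its equality case. -/
theorem two_mul_volume_lt_girth (hX : IsCompact X) (hconv : Convex ℝ X) (hne : X.Nonempty)
    (hL : girth X ≤ 2 * pi) (hdisk : ¬ IsDisk X) :
    2 * volume.real X < girth X := by
  obtain ⟨r, c, hr, hc, hA⟩ := volume_le_inradius_mul hX hconv hne
  have hLr : 2 * pi * r ≤ girth X := two_pi_mul_le_girth hX hne hc
  by_contra hcon
  push Not at hcon
  have hpi := Real.pi_pos
  have hr1 : r ≤ 1 := by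
    by_contra h; push Not at h; nlinarith
  -- Bonnesen together with `girth X ≤ 2 * π` and the assumed failure. If `r < 1` this forces `girth
  -- X ≤ 2 * π * r`; if `r = 1` the girth is pinched directly.
  have hfac : 0 ≤ (2 * pi * r - girth X) * (1 - r) := by nlinarith
  have hLpos : girth X = 2 * pi * r := by
    rcases eq_or_lt_of_le hr1 with h | h
    · subst h; linarith
    · have := nonneg_of_mul_nonneg_left hfac (by linarith); linarith
  apply hdisk
  refine ⟨c, r, ?_⟩
  have hcont : Continuous fun θ => supp X θ - (along θ c + r) := by
    have := continuous_supp hX hne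
    unfold along; fun_prop
  have hnn : ∀ θ, 0 ≤ supp X θ - (along θ c + r) := fun θ => sub_nonneg.2 (hc θ)
  have hint : ∫ θ in (0 : ℝ)..2 * pi, (supp X θ - (along θ c + r)) = 0 := by
    have ha : Continuous fun θ => along θ c := by unfold along; fun_prop
    rw [intervalIntegral.integral_sub (intervalIntegrable_supp hX hne _ _)
        ((ha.intervalIntegrable _ _).add (by simp)),
      intervalIntegral.integral_add (ha.intervalIntegrable _ _) (by simp), integral_along, ← girth,
      hLpos]
    simp
  have heq : ∀ θ ∈ Icc 0 (2 * pi), supp X θ = along θ c + r := by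
    intro θ hθ
    by_contra h
    have hpos' := intervalIntegral.integral_pos (a := 0) (b := 2 * pi) (by positivity)
      hcont.continuousOn (fun θ _ => hnn θ)
      ⟨θ, hθ, lt_of_le_of_ne (hnn θ) fun h' => h (by linarith)⟩
    linarith
  have hper : Function.Periodic (fun θ => supp X θ - along θ c) (2 * pi) := fun θ => by
    simp only [supp_add_two_pi, along_add_two_pi]
  have heq' : ∀ θ, supp X θ = along θ c + r := by
    intro θ
    obtain ⟨φ, hφ, h⟩ := hper.exists_mem_Ico₀ (by positivity) θ
    have := heq φ ⟨hφ.1, hφ.2.le⟩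
    linarith
  ext x
  rw [Metric.mem_closedBall, dist_eq_norm]
  constructor
  · intro hx
    obtain ⟨θ, hθ⟩ := exists_along_eq_norm (x - c)
    have h1 := along_le_supp hX hx θ
    rw [along_sub] at hθ
    rw [heq'] at h1
    linarith
  · intro hx
    refine mem_of_along_le_supp hX hconv hne fun θ => ?_
    have h1 := along_le θ (x - c)
    rw [along_sub] at h1
    rw [heq']
    linarith

end Erode

/-! ### Needles leaving the set, for a fixed angle -/

/-- The base points in `X` of the needles of length `l` and angle `θ` which leave `X`. -/
def escape (X : Set Plane) (l θ : ℝ) : Set Plane := {x | x ∈ X ∧ x + l • dir θ ∉ X}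

section Escape

variable {X : Set Plane}

lemma measurableSet_escape (hX : IsClosed X) (l θ : ℝ) : MeasurableSet (escape X l θ) :=
  hX.measurableSet.inter
    (hX.preimage (by fun_prop : Continuous fun x : Plane => x + l • dir θ)).measurableSet.compl

/-- The chord of `X` in direction `θ` at height `t`. -/
def chord (X : Set Plane) (θ t : ℝ) : Set ℝ := {s | frame θ (s, t) ∈ X}

lemma isCompact_chord (hX : IsCompact X) (θ t : ℝ) : IsCompact (chord X θ t) := by
  obtain ⟨R, -, hR⟩ := exists_norm_bound hX
  refine (isCompact_Icc (a := -R) (b := R)).of_isClosed_subset ?_ fun s hs => ?_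
  · exact hX.isClosed.preimage (by fun_prop : Continuous fun s => frame θ (s, t))
  · have h := (abs_along_le θ (frame θ (s, t))).trans (hR _ hs)
    rw [along_frame] at h
    exact abs_le.1 h

lemma exists_chord_eq_Icc (hX : IsCompact X) (hconv : Convex ℝ X) {θ t : ℝ}
    (hne : (chord X θ t).Nonempty) : ∃ p q, p ≤ q ∧ chord X θ t = Icc p q := by
  have hc := isCompact_chord hX θ t
  have hord : (chord X θ t).OrdConnected := by
    refine Convex.ordConnected fun s hs s' hs' a b ha hb hab => ?_
    have h := hconv hs hs' ha hb hab
    change frame θ (a • s + b • s', t) ∈ X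
    convert h using 1
    have ht : t = a * t + b * t := by rw [← add_mul, hab, one_mul]
    ext i
    fin_cases i
    · simp [frame]; linear_combination (-sin θ) * ht
    · simp [frame]; linear_combination (cos θ) * ht
  have h1 := hc.sInf_mem hne
  have h2 := hc.sSup_mem hne
  refine ⟨_, _, csInf_le_csSup hne hc.bddBelow hc.bddAbove, Subset.antisymm ?_ (hord.out h1 h2)⟩
  exact fun s hs => ⟨csInf_le hc.bddBelow hs, le_csSup hc.bddAbove hs⟩

lemma volume_escape (hX : IsClosed X) (l θ : ℝ) :
    volume (escape X l θ) =
      ∫⁻ t, volume {s | s ∈ chord X θ t ∧ s + l ∉ chord X θ t} := by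
  have hm := measurableSet_escape hX l θ
  rw [← volume_frame_preimage θ hm, Measure.volume_eq_prod,
    Measure.prod_apply_symm ((continuous_frame θ).measurable hm)]
  congr with t
  congr with s
  simp only [escape, chord, mem_preimage, mem_ofPred_eq, frame_add_smul_dir]

/-- On a chord `[p, q]` only base points in `(q - l, q]` can escape, so each height contributes at
most `l`. -/
lemma volume_escape_le (hX : IsCompact X) (hconv : Convex ℝ X) {l θ a b : ℝ} (hl : 0 ≤ l)
    (h : ∀ x ∈ X, along (θ + pi / 2) x ∈ Icc a b) :
    volume (escape X l θ) ≤ ENNReal.ofReal l * ENNReal.ofReal (b - a) := by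
  rw [volume_escape hX.isClosed, ← Real.volume_Icc, ← setLIntegral_const,
    ← lintegral_indicator measurableSet_Icc]
  refine lintegral_mono fun t => ?_
  rcases (chord X θ t).eq_empty_or_nonempty with he | hne
  · simp [he]
  have ht : t ∈ Icc a b := by
    obtain ⟨s, hs⟩ := hne
    simpa only [along_add_pi_div_two_frame] using h _ hs
  rw [indicator_of_mem ht]
  obtain ⟨p, q, -, hpq⟩ := exists_chord_eq_Icc hX hconv hne
  rw [hpq, show ENNReal.ofReal l = volume (Ioc (q - l) q) by rw [Real.volume_Ioc]; congr 1; ring]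
  refine measure_mono ?_
  rintro s ⟨h1, h2⟩
  refine ⟨?_, h1.2⟩
  by_contra hcon
  push Not at hcon
  exact h2 ⟨by linarith [h1.1], by linarith⟩

/-- A chord that contains one whole needle has length at least `l`, so all of `(q - l, q]` lies in
it and escapes. -/
lemma le_volume_escape (hX : IsCompact X) (hconv : Convex ℝ X) {l θ a b : ℝ}
    (h : ∀ t ∈ Icc a b, ∃ x ∈ X, along (θ + pi / 2) x = t ∧ x + l • dir θ ∈ X) :
    ENNReal.ofReal l * ENNReal.ofReal (b - a) ≤ volume (escape X l θ) := by
  rw [volume_escape hX.isClosed, ← Real.volume_Icc, ← setLIntegral_const,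
    ← lintegral_indicator measurableSet_Icc]
  refine lintegral_mono fun t => ?_
  by_cases ht : t ∈ Icc a b
  swap
  · simp [indicator_of_notMem ht]
  rw [indicator_of_mem ht]
  obtain ⟨x, hx, hxt, hxl⟩ := h t ht
  rw [← frame_along θ x, hxt] at hx hxl
  rw [frame_add_smul_dir] at hxl
  obtain ⟨p, q, -, hpq⟩ := exists_chord_eq_Icc hX hconv ⟨along θ x, hx⟩
  have h1 : along θ x ∈ Icc p q := hpq ▸ hx
  have h2 : along θ x + l ∈ Icc p q := hpq ▸ hxl
  rw [hpq, show ENNReal.ofReal l = volume (Ioc (q - l) q) by rw [Real.volume_Ioc]; congr 1; ring]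
  refine measure_mono ?_
  rintro s ⟨h3, h4⟩
  exact ⟨⟨by linarith [h1.1, h2.2], h4⟩, fun h5 => by linarith [h5.2]⟩

/-- The width of `X` orthogonally to the direction `θ`. -/
noncomputable def width (X : Set Plane) (θ : ℝ) : ℝ := supp X (θ + pi / 2) + supp X (θ - pi / 2)

lemma along_sub_pi_div_two (θ : ℝ) (x : Plane) :
    along (θ - pi / 2) x = -along (θ + pi / 2) x := by
  rw [← along_add_pi, ← along_add_two_pi]
  congr 1; ring

lemma width_nonneg (hX : IsCompact X) (hne : X.Nonempty) (θ : ℝ) : 0 ≤ width X θ := by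
  obtain ⟨x, hx⟩ := hne
  have h1 := along_le_supp hX hx (θ + pi / 2)
  have h2 := along_le_supp hX hx (θ - pi / 2)
  rw [along_sub_pi_div_two] at h2
  unfold width; linarith

lemma integral_width (hX : IsCompact X) (hne : X.Nonempty) :
    ∫ θ in (0 : ℝ)..2 * pi, width X θ = 2 * girth X := by
  have hc := continuous_supp hX hne
  unfold width
  rw [intervalIntegral.integral_add (Continuous.intervalIntegrable (by fun_prop) _ _)
    (Continuous.intervalIntegrable (by fun_prop) _ _), integral_supp_add]
  simp only [sub_eq_add_neg]
  rw [integral_supp_add]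
  ring

lemma continuous_width (hX : IsCompact X) (hne : X.Nonempty) : Continuous (width X) := by
  have hc := continuous_supp hX hne
  unfold width; fun_prop

/-- Contract `X` towards `c` by the factor `1 - η`. The needle from `(1 - η) • x + η • c` ends at
`(1 - η) • x + η • (c + (l / η) • dir θ)`, which is in `X` since `l / η ≤ ρ`. So chords at all
heights in an interval of length `(1 - η) * width X θ` have length at least `l`. -/
lemma mul_width_le_volume_escape (hX : IsCompact X) (hconv : Convex ℝ X) {c : Plane} {ρ : ℝ}
    (hball : Metric.closedBall c ρ ⊆ X) {η l : ℝ} (hη : 0 < η) (hη1 : η < 1) (hl : 0 ≤ l)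
    (hlρ : l ≤ η * ρ) (θ : ℝ) :
    ENNReal.ofReal (l * ((1 - η) * width X θ)) ≤ volume (escape X l θ) := by
  have hρ : 0 ≤ ρ := by
    by_contra h; push Not at h; nlinarith
  have hc : c ∈ X := hball (Metric.mem_closedBall_self hρ)
  have hc' : c + (l / η) • dir θ ∈ X := hball (by
    rw [Metric.mem_closedBall, dist_eq_norm, add_sub_cancel_left, norm_smul, norm_dir, mul_one,
      Real.norm_of_nonneg (by positivity), div_le_iff₀ hη]
    linarith)
  set T := along (θ + pi / 2) c
  have hη' : 0 < 1 - η := by linarith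
  have key := le_volume_escape hX hconv (l := l) (θ := θ) (a := (1 - η) * -supp X (θ - pi / 2) + η * T)
    (b := (1 - η) * supp X (θ + pi / 2) + η * T) ?_
  · rw [ENNReal.ofReal_mul hl]
    convert key using 3
    unfold width; ring
  intro t ht
  obtain ⟨x1, hx1, h1⟩ := exists_along_eq_supp hX ⟨c, hc⟩ (θ - pi / 2)
  obtain ⟨x2, hx2, h2⟩ := exists_along_eq_supp hX ⟨c, hc⟩ (θ + pi / 2)
  rw [along_sub_pi_div_two] at h1
  have hsub := (hconv.isPreconnected.image _ (continuous_along (θ + pi / 2)).continuousOn).Icc_subset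
    (mem_image_of_mem _ hx1) (mem_image_of_mem _ hx2)
  have ht' : (t - η * T) / (1 - η) ∈ Icc (along (θ + pi / 2) x1) (along (θ + pi / 2) x2) := by
    rw [mem_Icc, le_div_iff₀ hη', div_le_iff₀ hη', h2]
    constructor
    · rw [← h1, neg_neg] at ht; linarith [ht.1]
    · linarith [ht.2]
  obtain ⟨x, hx, hxt⟩ := hsub ht'
  refine ⟨(1 - η) • x + η • c, hconv hx hc hη'.le hη.le (by ring), ?_, ?_⟩
  · rw [along_add, along_smul, along_smul, hxt]
    rw [mul_div_cancel₀ _ hη'.ne', sub_add_cancel]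
  · have := hconv hx hc' hη'.le hη.le (by ring)
    rw [smul_add, smul_smul, mul_div_cancel₀ _ hη.ne', ← add_assoc] at this
    exact this

end Escape

/-! ### Bounds for the Buffon probability -/

section Probability

lemma needle_subset_iff {X : Set Plane} (hconv : Convex ℝ X) {l θ : ℝ} {x : Plane} :
    needle l x θ ⊆ X ↔ x ∈ X ∧ x + l • dir θ ∈ X :=
  ⟨fun h => ⟨h (left_mem_segment ..), h (right_mem_segment ..)⟩,
    fun h => hconv.segment_subset h.1 h.2⟩

lemma continuous_dir : Continuous dir := by
  unfold dir; fun_prop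

lemma isClosed_needle_subset {X : Set Plane} (hX : IsClosed X) (hconv : Convex ℝ X) (l : ℝ) :
    IsClosed {p : Plane × ℝ | needle l p.1 p.2 ⊆ X} := by
  simp only [needle_subset_iff hconv]
  have hd := continuous_dir
  exact (hX.preimage continuous_fst).inter
    (hX.preimage (by fun_prop : Continuous fun p : Plane × ℝ => p.1 + l • dir p.2))

instance : IsProbabilityMeasure uniformAngle :=
  ProbabilityTheory.cond_isProbabilityMeasure_of_finite (by simp [Real.pi_pos])
    (by rw [Real.volume_Ico]; exact ENNReal.ofReal_ne_top)

lemma lintegral_uniformAngle (f : ℝ → ENNReal) :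
    ∫⁻ θ, f θ ∂uniformAngle = (ENNReal.ofReal (2 * pi))⁻¹ * ∫⁻ θ in Ico 0 (2 * pi), f θ := by
  rw [uniformAngle, ProbabilityTheory.cond, lintegral_smul_measure, Real.volume_Ico, sub_zero,
    smul_eq_mul]

lemma buffonProb_eq {X : Set Plane} (hX : IsCompact X) (hconv : Convex ℝ X)
    (h0 : volume X ≠ 0) (l : ℝ) :
    buffonProb X l = 1 - ((ENNReal.ofReal (2 * pi))⁻¹ *
      ∫⁻ θ in Ico 0 (2 * pi), (volume X)⁻¹ * volume (escape X l θ)).toReal := by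
  have hu : uniformPoint X = ProbabilityTheory.cond volume X := by
    rw [uniformPoint, if_pos h0]
  have hprob : IsProbabilityMeasure (ProbabilityTheory.cond volume X) :=
    ProbabilityTheory.cond_isProbabilityMeasure_of_finite h0 hX.measure_lt_top.ne
  have hm := (isClosed_needle_subset hX.isClosed hconv l).measurableSet
  rw [buffonProb, hu, ← compl_compl {p : Plane × ℝ | needle l p.1 p.2 ⊆ X},
    probReal_compl_eq_one_sub hm.compl, measureReal_def, Measure.prod_apply_symm hm.compl,
    lintegral_uniformAngle]
  congr 4
  ext θ
  rw [ProbabilityTheory.cond_apply hX.measurableSet]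
  congr 2
  ext x
  simp only [escape, needle_subset_iff hconv, mem_inter_iff, mem_preimage, mem_compl_iff,
    mem_ofPred_eq]
  tauto

lemma buffonProb_le {X : Set Plane} (hX : IsCompact X) (hconv : Convex ℝ X)
    (h0 : volume X ≠ 0) {c : Plane} {ρ : ℝ}
    (hball : Metric.closedBall c ρ ⊆ X) {η l : ℝ} (hη : 0 < η) (hη1 : η < 1) (hl : 0 ≤ l)
    (hlρ : l ≤ η * ρ) :
    buffonProb X l ≤ 1 - l * (1 - η) * girth X / (pi * volume.real X) := by
  have hne : X.Nonempty := nonempty_of_measure_ne_zero h0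
  have hA : 0 < volume.real X := ENNReal.toReal_pos h0 hX.measure_lt_top.ne
  have hw := continuous_width hX hne
  rw [buffonProb_eq hX hconv h0]
  have h1 : ENNReal.ofReal (l * (1 - η) * girth X / (pi * volume.real X)) ≤
      (ENNReal.ofReal (2 * pi))⁻¹ *
      ∫⁻ θ in Ico 0 (2 * pi), (volume X)⁻¹ * volume (escape X l θ) := by
    calc _ = (ENNReal.ofReal (2 * pi))⁻¹ * ∫⁻ θ in Ico 0 (2 * pi),
          ENNReal.ofReal ((volume.real X)⁻¹ * (l * ((1 - η) * width X θ))) := by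
          rw [← ofReal_integral_eq_lintegral_ofReal, integral_Ico_eq_integral_Ioc,
            ← intervalIntegral.integral_of_le (by positivity), intervalIntegral.integral_const_mul,
            intervalIntegral.integral_const_mul, intervalIntegral.integral_const_mul,
            integral_width hX hne, ← ENNReal.ofReal_inv_of_pos (by positivity),
            ← ENNReal.ofReal_mul (by positivity)]
          · congr 1
            field_simp
          · exact (Continuous.integrableOn_Icc (by fun_prop)).mono_set Ico_subset_Icc_self
          · refine ae_of_all _ fun θ => ?_
            have := width_nonneg hX hne θ
            have : 0 ≤ 1 - η := by linarith
            simp only [Pi.zero_apply]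
            positivity
      _ ≤ _ := by
          gcongr with θ
          rw [ENNReal.ofReal_mul (by positivity), ENNReal.ofReal_inv_of_pos hA, ofReal_measureReal
            hX.measure_lt_top.ne]
          gcongr
          exact mul_width_le_volume_escape hX hconv hball hη hη1 hl hlρ θ
  -- The real-valued comparison needs finiteness; escaping points lie in `X`, so the normalised
  -- integrand is at most one.
  have hfin : (ENNReal.ofReal (2 * pi))⁻¹ *
      ∫⁻ θ in Ico 0 (2 * pi), (volume X)⁻¹ * volume (escape X l θ) ≠ ⊤ := by
    refine ENNReal.mul_ne_top (by simp [Real.pi_pos]) (ne_of_lt ?_)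
    calc _ ≤ ∫⁻ θ in Ico 0 (2 * pi), 1 := by
          gcongr with θ
          refine (mul_le_mul_right (measure_mono fun x hx => hx.1) _).trans ?_
          exact (ENNReal.inv_mul_cancel h0 hX.measure_lt_top.ne).le
      _ < ⊤ := by rw [setLIntegral_const, Real.volume_Ico]; simp [ENNReal.mul_lt_top]
  have := (ENNReal.ofReal_le_iff_le_toReal hfin).1 h1
  linarith

/-- The disk has width `2` in every direction and area `π`, so at each angle at most the fraction `2
* l / π` of base points escapes. -/
lemma unitDisk_le_buffonProb {l : ℝ} (hl : 0 ≤ l) : 1 - 2 * l / pi ≤ buffonProb unitDisk l := by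
  have hpi := Real.pi_pos
  have hv : volume unitDisk = ENNReal.ofReal pi := by
    rw [unitDisk, EuclideanSpace.volume_closedBall_fin_two]; simp
  have hX : IsCompact unitDisk := isCompact_closedBall 0 1
  have hconv : Convex ℝ unitDisk := convex_closedBall 0 1
  rw [buffonProb_eq hX hconv (by rw [hv]; simpa using hpi)]
  have h1 : (ENNReal.ofReal (2 * pi))⁻¹ *
      ∫⁻ θ in Ico 0 (2 * pi), (volume unitDisk)⁻¹ * volume (escape unitDisk l θ) ≤
      ENNReal.ofReal (2 * l / pi) := by
    calc _ ≤ (ENNReal.ofReal (2 * pi))⁻¹ * ∫⁻ θ in Ico 0 (2 * pi), ENNReal.ofReal (2 * l / pi) := by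
          gcongr with θ
          refine (mul_le_mul_right (volume_escape_le hX hconv hl (a := -1) (b := 1) ?_) _).trans ?_
          · intro x hx
            rw [unitDisk, mem_closedBall_zero_iff] at hx
            exact abs_le.1 ((abs_along_le _ x).trans hx)
          · rw [hv, ← ENNReal.ofReal_inv_of_pos hpi, ← ENNReal.ofReal_mul hl,
              ← ENNReal.ofReal_mul (by positivity)]
            refine ENNReal.ofReal_le_ofReal (le_of_eq ?_)
            field_simp; ring
      _ = _ := by
          rw [setLIntegral_const, Real.volume_Ico, sub_zero, mul_comm (ENNReal.ofReal (2 * l / pi)),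
            ← mul_assoc, ENNReal.inv_mul_cancel (by simpa using hpi) ENNReal.ofReal_ne_top, one_mul]
  have := ENNReal.toReal_le_of_le_ofReal (by positivity) h1
  linarith

lemma ae_cos_sub_ne_zero (φ : ℝ) : ∀ᵐ θ : ℝ, cos (θ - φ) ≠ 0 := by
  have : {θ | ¬cos (θ - φ) ≠ 0} ⊆ range fun k : ℤ => (2 * k + 1) * pi / 2 + φ := by
    intro θ hθ
    simp only [ne_eq, not_not, mem_ofPred_eq] at hθ
    obtain ⟨k, hk⟩ := Real.cos_eq_zero_iff.1 hθ
    exact ⟨k, by simp only; linarith⟩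
  exact measure_mono_null this ((countable_range _).measure_zero volume)

/-- A convex set without interior does not affinely span the plane, so a nonzero vector is
orthogonal to all its differences. -/
lemma exists_along_eq_const {X : Set Plane} (hconv : Convex ℝ X) (hint : interior X = ∅) :
    ∃ φ, ∀ x ∈ X, ∀ y ∈ X, along φ x = along φ y := by
  have hspan : vectorSpan ℝ X ≠ ⊤ := by
    intro h
    rcases X.eq_empty_or_nonempty with rfl | hne
    · simp at h
    · have h1 := (AffineSubspace.affineSpan_eq_top_iff_vectorSpan_eq_top_of_nonempty ℝ Plane Plane
        hne).2 h
      rw [← hconv.interior_nonempty_iff_affineSpan_eq_top, hint] at h1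
      exact not_nonempty_empty h1
  obtain ⟨v, hv, hv0⟩ := Submodule.exists_mem_ne_zero_of_ne_bot
    (fun h => hspan (Submodule.orthogonal_eq_bot_iff.1 h))
  obtain ⟨φ, hφ⟩ := exists_eq_norm_smul_dir v
  refine ⟨φ, fun x hx y hy => ?_⟩
  have h1 := (Submodule.mem_orthogonal _ _).1 hv _ (vsub_mem_vectorSpan ℝ hx hy)
  rw [hφ, inner_smul_right, ← along_eq_inner, vsub_eq_sub, along_sub] at h1
  have := (mul_eq_zero.1 h1).resolve_left (norm_ne_zero_iff.2 hv0)
  linarith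

/-- A needle inside a line must be parallel to it, which confines the angle to a countable set,
whatever the base point. -/
lemma buffonProb_eq_zero {X : Set Plane} (hX : IsClosed X) (hconv : Convex ℝ X)
    (h0 : volume X = 0) {l : ℝ} (hl : 0 < l) [SFinite (uniformPoint X)] : buffonProb X l = 0 := by
  have hint : interior X = ∅ := Measure.interior_eq_empty_of_null h0
  obtain ⟨φ, hφ⟩ := exists_along_eq_const hconv hint
  have hm := (isClosed_needle_subset hX hconv l).measurableSet
  rw [buffonProb, measureReal_def, (Measure.measure_prod_null hm).2, ENNReal.toReal_zero]
  refine ae_of_all _ fun x => ?_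
  have hae : ∀ᵐ θ ∂uniformAngle, cos (θ - φ) ≠ 0 :=
    (ProbabilityTheory.cond_absolutelyContinuous (μ := volume)).ae_le (ae_cos_sub_ne_zero φ)
  refine measure_mono_null (fun θ hθ => ?_) hae
  simp only [mem_preimage, mem_ofPred_eq, needle_subset_iff hconv] at hθ
  have h1 := hφ _ hθ.2 _ hθ.1
  rw [along_add, along_smul, along_dir, ← neg_sub, Real.cos_neg] at h1
  have h2 : l * cos (θ - φ) = 0 := by linarith
  simpa [hl.ne'] using h2

end Probability

/-! ### Comparing the girth with the boundary length -/

/-- The distance from `x` is 1-Lipschitz and maps the connected set onto a superset of `[0, dist x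
y]`. -/
lemma dist_le_hausdorffMeasure {E : Type*} [MetricSpace E] [MeasurableSpace E] [BorelSpace E]
    {s : Set E} (hs : IsPreconnected s) {x y : E} (hx : x ∈ s) (hy : y ∈ s) :
    ENNReal.ofReal (dist x y) ≤ Measure.hausdorffMeasure 1 s := by
  have hl : LipschitzWith 1 (dist x) := LipschitzWith.dist_right x
  have h1 := hl.hausdorffMeasure_image_le zero_le_one s
  simp only [ENNReal.coe_one, ENNReal.one_rpow, one_mul] at h1
  refine le_trans ?_ h1
  have h2 := (hs.image _ hl.continuous.continuousOn).Icc_subset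
    (mem_image_of_mem _ hx) (mem_image_of_mem _ hy)
  rw [dist_self] at h2
  rw [← sub_zero (dist x y), ← Real.volume_Icc, hausdorffMeasure_real]
  exact measure_mono h2

lemma ofReal_dist_le_hausdorffMeasure_arc {γ : ℝ → Plane} (hγ : Continuous γ) {a b : ℝ}
    (hab : a ≤ b) :
    ENNReal.ofReal (dist (γ a) (γ b)) ≤ Measure.hausdorffMeasure 1 (γ '' Ico a b) := by
  have h1 := dist_le_hausdorffMeasure (isPreconnected_Icc.image γ hγ.continuousOn)
    (mem_image_of_mem γ (left_mem_Icc.2 hab)) (mem_image_of_mem γ (right_mem_Icc.2 hab))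
  refine h1.trans ?_
  -- Half-open arcs make consecutive pieces disjoint; the dropped endpoint is a null set.
  have : NullSingletonClass (Measure.hausdorffMeasure 1 : Measure Plane) :=
    Measure.nullSingletonClass_hausdorff Plane zero_lt_one
  rw [← Ico_union_right hab, image_union, image_singleton]
  exact (measure_union_le _ _).trans (by simp)

/-- The length of an inscribed polygon is at most the length of the curve. -/
lemma sum_dist_le_hausdorffMeasure {γ : ℝ → Plane} (hγ : Continuous γ) {F : Set Plane} {n : ℕ}
    {t : ℕ → ℝ} (ht : Monotone t) (hinj : InjOn γ (Ico (t 0) (t n)))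
    (hF : ∀ s, γ s ∈ F) (hfin : Measure.hausdorffMeasure 1 F ≠ ⊤) :
    ∑ k ∈ Finset.range n, dist (γ (t k)) (γ (t (k + 1))) ≤
      (Measure.hausdorffMeasure 1 F).toReal := by
  rw [← ENNReal.ofReal_le_iff_le_toReal hfin, ENNReal.ofReal_sum_of_nonneg fun _ _ => dist_nonneg]
  have hsub : ∀ k ∈ Finset.range n, Ico (t k) (t (k + 1)) ⊆ Ico (t 0) (t n) := fun k hk =>
    Ico_subset_Ico (ht (Nat.zero_le _)) (ht (Finset.mem_range.1 hk))
  calc _ ≤ ∑ k ∈ Finset.range n, Measure.hausdorffMeasure 1 (γ '' Ico (t k) (t (k + 1))) :=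
        Finset.sum_le_sum fun k _ => ofReal_dist_le_hausdorffMeasure_arc hγ (ht (Nat.le_succ k))
    _ = Measure.hausdorffMeasure 1 (⋃ k ∈ Finset.range n, γ '' Ico (t k) (t (k + 1))) := by
        refine (measure_biUnion_finset (fun i hi j hj hij => ?_) fun k hk => ?_).symm
        · refine disjoint_left.2 ?_
          rintro _ ⟨a, ha, rfl⟩ ⟨b, hb, hab⟩
          rw [hinj (hsub j hj hb) (hsub i hi ha) hab] at hb
          exact disjoint_left.1 (ht.pairwise_disjoint_on_Ico_succ hij) ha hb
        · exact measurableSet_Ico.image_of_continuousOn_injOn hγ.continuousOn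
            (hinj.mono (hsub k hk))
    _ ≤ _ := by
        refine measure_mono (iUnion₂_subset fun k _ => ?_)
        rintro _ ⟨s, -, rfl⟩
        exact hF s

/-- Two vertices split a closed polygon into two paths, each at least as long as their distance. -/
lemma two_mul_dist_le_sum {a : ℕ → ℝ} {n : ℕ} (hn : a n = a 0) {j k : ℕ} (hj : j ≤ n)
    (hk : k ≤ n) : 2 * dist (a j) (a k) ≤ ∑ i ∈ Finset.range n, dist (a i) (a (i + 1)) := by
  wlog hjk : j ≤ k generalizing j k
  · rw [dist_comm]; exact this hk hj (le_of_not_ge hjk)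
  have h1 := dist_le_Ico_sum_dist a (Nat.zero_le j)
  have h2 := dist_le_Ico_sum_dist a hjk
  have h3 := dist_le_Ico_sum_dist a hk
  rw [Finset.range_eq_Ico, ← Finset.sum_Ico_consecutive _ (Nat.zero_le j) hj,
    ← Finset.sum_Ico_consecutive _ hjk hk]
  have h4 := dist_triangle_left (a j) (a k) (a 0)
  rw [hn, dist_comm (a k)] at h3
  linarith

/-- The integrand is `‖v‖` times a shift of `|cos|`, whose integral over each of the two periods of
length `π` is `2`. -/
lemma integral_abs_along (v : Plane) : ∫ φ in (0 : ℝ)..2 * pi, |along φ v| = 4 * ‖v‖ := by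
  obtain ⟨ψ, hψ⟩ := exists_eq_norm_smul_dir v
  have h : ∀ φ, |along φ v| = ‖v‖ * |cos (φ - ψ)| := fun φ => by
    conv_lhs => rw [hψ]
    rw [along_smul, along_dir, abs_mul, abs_of_nonneg (norm_nonneg v)]
  have hc : Continuous fun x => |cos x| := by fun_prop
  have hp : Function.Periodic (fun x => |cos x|) pi := fun x => by simp [Real.cos_add_pi]
  have h0 : ∫ x in (-(pi / 2))..(-(pi / 2) + pi), |cos x| = 2 := by
    have : ∫ x in (-(pi / 2))..(-(pi / 2) + pi), |cos x| = ∫ x in (-(pi / 2))..(pi / 2), cos x := by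
      rw [show -(pi / 2) + pi = pi / 2 by ring]
      refine intervalIntegral.integral_congr fun x hx => ?_
      rw [uIcc_of_le (by linarith [Real.pi_pos])] at hx
      exact abs_of_nonneg (Real.cos_nonneg_of_mem_Icc hx)
    rw [this, integral_cos]; simp; norm_num
  simp only [h]
  rw [intervalIntegral.integral_const_mul, intervalIntegral.integral_comp_sub_right
    (fun x => |cos x|), ← intervalIntegral.integral_add_adjacent_intervals (b := 0 - ψ + pi)
    (hc.intervalIntegrable _ _) (hc.intervalIntegrable _ _),
    hp.intervalIntegral_add_eq (0 - ψ) (-(pi / 2)), show 2 * pi - ψ = 0 - ψ + pi + pi by ring,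
    hp.intervalIntegral_add_eq (0 - ψ + pi) (-(pi / 2)), h0]
  ring

lemma dir_injOn : InjOn dir (Ico 0 (2 * pi)) := by
  intro θ hθ φ hφ h
  have h1 : along θ (dir θ) = along θ (dir φ) := by rw [h]
  rw [along_dir, along_dir, sub_self, Real.cos_zero] at h1
  have := (Real.cos_eq_one_iff_of_lt_of_lt (by linarith [hθ.1, hφ.2]) (by linarith [hθ.2, hφ.1])).1
    h1.symm
  linarith

lemma dir_add_two_pi (θ : ℝ) : dir (θ + 2 * pi) = dir θ := by simp [dir]

/-- The radial parametrisation of the boundary of a convex body. -/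
lemma exists_boundary_curve {X : Set Plane} (hX : IsCompact X) (hconv : Convex ℝ X)
    (hint : (interior X).Nonempty) :
    ∃ γ : ℝ → Plane, Continuous γ ∧ Function.Periodic γ (2 * pi) ∧ InjOn γ (Ico 0 (2 * pi)) ∧
      range γ = frontier X := by
  obtain ⟨c, hc⟩ := hint
  set e : Plane ≃ₜ Plane := Homeomorph.addRight c
  set Y : Set Plane := e ⁻¹' X
  have hY0 : Y ∈ 𝓝 0 := by
    refine e.continuous.continuousAt.preimage_mem_nhds ?_
    simpa [e] using mem_interior_iff_mem_nhds.1 hc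
  have hYconv : Convex ℝ Y := hconv.translate_preimage_left c
  have hYbdd : Bornology.IsVonNBounded ℝ Y :=
    NormedSpace.isVonNBounded_of_isBounded ℝ (e.isCompact_preimage.2 hX).isBounded
  -- Centred at an interior point, the boundary is the unit level of the gauge, so each ray meets it
  -- exactly once.
  have hfr : ∀ x, e x ∈ frontier X ↔ gauge Y x = 1 := fun x => by
    rw [gauge_eq_one_iff_mem_frontier hYconv hY0, ← e.preimage_frontier]; rfl
  have hg := continuous_gauge hYconv hY0
  have hne : ∀ θ, dir θ ≠ 0 := fun θ h => by simpa [h] using norm_dir θ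
  have hpos : ∀ θ, 0 < gauge Y (dir θ) := fun θ =>
    (gauge_pos (absorbent_nhds_zero hY0) hYbdd).2 (hne θ)
  have hd := continuous_dir
  refine ⟨fun θ => e ((gauge Y (dir θ))⁻¹ • dir θ), ?_, ?_, ?_, ?_⟩
  · exact e.continuous.comp (((hg.comp hd).inv₀ fun θ => (hpos θ).ne').smul hd)
  · intro θ; simp only [dir_add_two_pi]
  · intro θ hθ φ hφ h
    have h1 := e.injective h
    have h2 := congrArg norm h1
    rw [norm_smul, norm_smul, norm_dir, norm_dir, mul_one, mul_one,
      Real.norm_of_nonneg (inv_nonneg.2 (hpos θ).le), Real.norm_of_nonneg (inv_nonneg.2 (hpos φ).le)]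
      at h2
    rw [h2] at h1
    exact dir_injOn hθ hφ (smul_right_injective _ (inv_ne_zero (hpos φ).ne') h1)
  · ext x
    constructor
    · rintro ⟨θ, rfl⟩
      rw [hfr, gauge_smul_of_nonneg (inv_nonneg.2 (hpos θ).le), smul_eq_mul,
        inv_mul_cancel₀ (hpos θ).ne']
    · intro hx
      obtain ⟨y, rfl⟩ := e.surjective x
      rw [hfr] at hx
      obtain ⟨θ, hθ⟩ := exists_eq_norm_smul_dir y
      refine ⟨θ, ?_⟩
      rw [hθ, gauge_smul_of_nonneg (norm_nonneg _), smul_eq_mul] at hx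
      simp only [← eq_inv_of_mul_eq_one_left hx]
      rw [← hθ]

/-- Around an interior point one could move further in direction `θ`. -/
lemma mem_frontier_of_along_eq_supp {X : Set Plane} (hX : IsCompact X) {x : Plane} (hx : x ∈ X)
    {θ : ℝ} (h : along θ x = supp X θ) : x ∈ frontier X := by
  refine ⟨subset_closure hx, fun hint => ?_⟩
  obtain ⟨ε, hε, hball⟩ := Metric.nhds_basis_closedBall.mem_iff.1
    (mem_interior_iff_mem_nhds.1 hint)
  have hm : x + ε • dir θ ∈ Metric.closedBall x ε := by
    simp [Metric.mem_closedBall, dist_eq_norm, norm_smul, norm_dir, abs_of_pos hε]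
  have h1 := along_le_supp hX (hball hm) θ
  rw [along_add, along_smul, along_dir, sub_self, Real.cos_zero] at h1
  linarith

/-- One half of Cauchy's formula for the perimeter. -/
theorem girth_le_perimeter {X : Set Plane} (hX : IsCompact X) (hconv : Convex ℝ X)
    (hint : (interior X).Nonempty) (hfin : perimeter X ≠ ⊤) : girth X ≤ (perimeter X).toReal := by
  have hne : X.Nonempty := hint.mono interior_subset
  have hpi := Real.pi_pos
  obtain ⟨γ, hγ, hper, hinj, hrange⟩ := exists_boundary_curve hX hconv hint
  refine le_of_forall_pos_le_add fun ε' hε' => ?_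
  obtain ⟨ε, hε, hεε'⟩ : ∃ ε, 0 < ε ∧ 2 * pi * ε ≤ ε' :=
    ⟨ε' / (2 * pi), by positivity, by rw [mul_div_cancel₀ _ (by positivity)]⟩
  obtain ⟨δ, hδ, hunif⟩ := Metric.uniformContinuousOn_iff.1
    ((isCompact_Icc (a := 0) (b := 2 * pi)).uniformContinuousOn_of_continuous hγ.continuousOn) ε hε
  obtain ⟨n, hn⟩ := exists_nat_gt (2 * pi / δ)
  have hn0 : (0 : ℝ) < n := lt_trans (by positivity) hn
  have hstep : 2 * pi / n < δ := by
    rw [div_lt_iff₀ hδ] at hn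
    rw [div_lt_iff₀ hn0]; linarith
  set t : ℕ → ℝ := fun k => k * (2 * pi / n) with ht
  have ht0 : t 0 = 0 := by simp [ht]
  have htn : t n = 2 * pi := by simp only [ht]; field_simp
  have htmono : Monotone t := fun i j hij => by
    have : (i : ℝ) ≤ j := by exact_mod_cast hij
    exact mul_le_mul_of_nonneg_right this (by positivity)
  have hsum := sum_dist_le_hausdorffMeasure (n := n) hγ htmono (by rwa [ht0, htn])
    (fun s => hrange ▸ mem_range_self s) hfin
  have hclosed : γ (t n) = γ (t 0) := by
    rw [ht0, htn]; simpa using hper 0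
  have happrox : ∀ x ∈ frontier X, ∃ k ≤ n, dist x (γ (t k)) ≤ ε := by
    intro x hx
    rw [← hrange] at hx
    obtain ⟨α', rfl⟩ := hx
    obtain ⟨α, hα, hαe⟩ := hper.exists_mem_Ico₀ (by positivity) α'
    have hq : 0 ≤ α / (2 * pi / n) := div_nonneg hα.1 (by positivity)
    have hd : 0 < 2 * pi / n := by positivity
    have h1 : t ⌊α / (2 * pi / n)⌋₊ ≤ α := (le_div_iff₀ hd).1 (Nat.floor_le hq)
    have h2 : α < t ⌊α / (2 * pi / n)⌋₊ + 2 * pi / n := by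
      have := (div_lt_iff₀ hd).1 (Nat.lt_floor_add_one (α / (2 * pi / n)))
      rw [add_one_mul] at this
      exact this
    refine ⟨⌊α / (2 * pi / n)⌋₊, ?_, ?_⟩
    · refine Nat.floor_le_of_le ?_
      rw [div_le_iff₀ hd, mul_div_cancel₀ _ hn0.ne']
      exact hα.2.le
    · rw [hαe]
      refine (hunif α ⟨hα.1, hα.2.le⟩ _ ⟨by positivity, h1.trans hα.2.le⟩ ?_).le
      rw [Real.dist_eq, abs_lt]; constructor <;> linarith
  -- The projected closed polygon runs back and forth between near-extremal vertices, so it covers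
  -- the width twice up to the approximation error. Integrated over `φ`, this reads `2 * girth X ≤ 2
  -- * (polygon length) + 4 * π * ε`.
  have hbound : ∀ φ, supp X φ + supp X (φ + pi) ≤
      (∑ k ∈ Finset.range n, |along φ (γ (t k) - γ (t (k + 1)))|) / 2 + 2 * ε := by
    intro φ
    obtain ⟨x, hx, hxs⟩ := exists_along_eq_supp hX hne φ
    obtain ⟨y, hy, hys⟩ := exists_along_eq_supp hX hne (φ + pi)
    obtain ⟨j, hj, hxj⟩ := happrox x (mem_frontier_of_along_eq_supp hX hx hxs)
    obtain ⟨k, hk, hyk⟩ := happrox y (mem_frontier_of_along_eq_supp hX hy hys)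
    have h := two_mul_dist_le_sum (a := fun i => along φ (γ (t i))) (n := n) (by rw [hclosed]) hj hk
    simp only [Real.dist_eq, ← along_sub] at h
    rw [dist_eq_norm] at hxj hyk
    have h1 := (along_le φ (x - γ (t j))).trans hxj
    have h2 := (neg_le_abs _).trans ((abs_along_le φ (y - γ (t k))).trans hyk)
    have h3 : along φ (γ (t j)) - along φ (γ (t k)) ≤ |along φ (γ (t j) - γ (t k))| := by
      rw [← along_sub]; exact le_abs_self _
    rw [along_sub] at h1 h2
    rw [← hxs, ← hys, along_add_pi]
    linarith
  have hc := continuous_supp hX hne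
  have hca : ∀ v, Continuous fun φ => |along φ v| := fun v => by unfold along; fun_prop
  have hcs : Continuous fun φ => (∑ k ∈ Finset.range n, |along φ (γ (t k) - γ (t (k + 1)))|) / 2 :=
    (continuous_finsetSum _ fun k _ => hca _).div_const 2
  have hI := intervalIntegral.integral_mono_on (μ := volume) (a := 0) (b := 2 * pi) (by positivity)
    (Continuous.intervalIntegrable (by fun_prop) _ _)
    ((hcs.intervalIntegrable _ _).add (by simp)) fun φ _ => hbound φ
  rw [intervalIntegral.integral_add (hc.intervalIntegrable _ _)
      (Continuous.intervalIntegrable (by fun_prop) _ _),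
    integral_supp_add, ← girth, intervalIntegral.integral_add (hcs.intervalIntegrable _ _) (by simp),
    intervalIntegral.integral_div, intervalIntegral.integral_finsetSum fun k _ =>
      (hca _).intervalIntegrable _ _] at hI
  simp only [integral_abs_along, ← dist_eq_norm, ← Finset.mul_sum] at hI
  simp only [intervalIntegral.integral_const, sub_zero, smul_eq_mul] at hI
  rw [perimeter]
  linarith

end Buffon

/-! ### The comparison with the disk -/

theorem theorem1 (X : Set Plane) (hcompact : IsCompact X) (hconvex : Convex ℝ X)
    (hperimeter : perimeter X = ENNReal.ofReal (2 * Real.pi)) (hdisk : ¬ IsDisk X) :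
    ∃ ε : ℝ, 0 < ε ∧ ∀ l : ℝ, l ∈ Set.Ioo 0 ε → buffonProb X l < buffonProb unitDisk l := by
  have hpi := Real.pi_pos
  by_cases h0 : MeasureTheory.volume X = 0
  · have hint : interior X = ∅ := MeasureTheory.Measure.interior_eq_empty_of_null h0
    have hH : MeasureTheory.Measure.hausdorffMeasure 1 X = ENNReal.ofReal (2 * Real.pi) := by
      rw [← hperimeter, perimeter, frontier, hint, Set.sdiff_empty, hcompact.isClosed.closure_eq]
    have hu : uniformPoint X =
        ProbabilityTheory.cond (MeasureTheory.Measure.hausdorffMeasure 1) X := by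
      rw [uniformPoint, if_neg (not_not.2 h0), if_pos (by rw [hH]; simpa using hpi)]
    have hfin : MeasureTheory.IsProbabilityMeasure (uniformPoint X) := by
      rw [hu]
      exact ProbabilityTheory.cond_isProbabilityMeasure_of_finite (by rw [hH]; simpa using hpi)
        (by rw [hH]; exact ENNReal.ofReal_ne_top)
    -- For `l < π / 2` the lower bound `1 - 2 * l / π` for the disk is positive.
    refine ⟨Real.pi / 2, by positivity, fun l hl => ?_⟩
    rw [Buffon.buffonProb_eq_zero hcompact.isClosed hconvex h0 hl.1]
    refine lt_of_lt_of_le ?_ (Buffon.unitDisk_le_buffonProb hl.1.le)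
    rw [sub_pos, div_lt_one hpi]
    linarith [hl.2]
  · have hint : (interior X).Nonempty := by
      by_contra h
      rw [Set.not_nonempty_iff_eq_empty] at h
      have h1 := hconvex.addHaar_frontier MeasureTheory.volume
      rw [frontier, h, Set.sdiff_empty, hcompact.isClosed.closure_eq] at h1
      exact h0 h1
    have hne : X.Nonempty := hint.mono interior_subset
    have hA : 0 < MeasureTheory.volume.real X :=
      ENNReal.toReal_pos h0 hcompact.measure_lt_top.ne
    have hL := Buffon.girth_le_perimeter hcompact hconvex hint
      (by rw [hperimeter]; exact ENNReal.ofReal_ne_top)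
    rw [hperimeter, ENNReal.toReal_ofReal (by positivity)] at hL
    have hiso := Buffon.two_mul_volume_lt_girth hcompact hconvex hne hL hdisk
    obtain ⟨c, hc⟩ := hint
    obtain ⟨ρ, hρ, hball⟩ := Metric.nhds_basis_closedBall.mem_iff.1
      (mem_interior_iff_mem_nhds.1 hc)
    set A := MeasureTheory.volume.real X
    set L := Buffon.girth X
    have hLpos : 0 < L := by linarith
    -- The loss `η` from contracting `X` is chosen small enough to keep `2 * A < (1 - η) * L`;
    -- needles up to length `η * ρ` are then controlled by the inscribed ball.
    obtain ⟨η, hη, hηL⟩ := exists_between (show 0 < 1 - 2 * A / L by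
      rw [sub_pos, div_lt_one hLpos]; exact hiso)
    have hη1 : η < 1 := by
      have : 0 < 2 * A / L := by positivity
      linarith
    refine ⟨η * ρ, by positivity, fun l hl => ?_⟩
    refine lt_of_le_of_lt (Buffon.buffonProb_le hcompact hconvex h0 hball hη hη1 hl.1.le hl.2.le)
      (lt_of_lt_of_le ?_ (Buffon.unitDisk_le_buffonProb hl.1.le))
    have h1 : 2 * A < (1 - η) * L := by
      have : 2 * A / L < 1 - η := by linarith
      exact (div_lt_iff₀ hLpos).1 this
    have hl0 := hl.1
    rw [sub_lt_sub_iff_left, div_lt_div_iff₀ hpi (by positivity)]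
    have h2 := mul_lt_mul_of_pos_left h1 (mul_pos hl0 hpi)
    linarith
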